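/- Let $m=(m_0,m_1,\dots)$ be a sequence of integers $m_k\ge 2$, let $G_m=\prod_{k\ge 0} Z_{m_k}$ with $Z_{m_k}=\{0,\dots,m_k-1\}$ the cyclic group of order $m_k$, and let $\mu$ be the normalized Haar measure of $G_m$ (the product of the uniform measures on the $Z_{m_k}$). Put $M_0=1$, $M_{k+1}=m_kM_k$, write each $n\in\mathbb N=\{0,1,\dots\}$ as $n=\sum_j n_jM_j$ with $0\le n_j<m_j$, and let $\psi_n(x)=\prod_k \exp(2\pi i x_k/m_k)^{n_k}$ be the Vilenkin functions on $G_m$. Let $\mathcal F_n$ be the $\sigma$-algebra generated by the sets $I_n(x)=\{y\in G_m: y_0=x_0,\dots,y_{n-1}=x_{n-1}\}$, $x\in G_m$. For $0<p<1$ the Hardy space $H_p(G_m)$ consists of the complex martingales $f=(f_n)_{n\ge0}$ with respect to $(\mathcal F_n)$ for which $\|f\|_{H_p}:=\|\sup_n|f_n|\|_p<\infty$. For a martingale $f$ let $\widehat f(i)=\lim_{k\to\infty}\int f_k\overline{\psi_i}\,d\mu$, $S_kf=\sum_{i<k}\widehat f(i)\psi_i$, and $\omega(1/M_n,f)_{H_p}=\|f-S_{M_n}f\|_{H_p}$,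 where $f-S_{M_n}f$ is the martingale $(f_k-S_{M_n}f_k)_{k\ge0}$. Let $\|g\|_{L_{p,\infty}}=\sup_{t>0}t\,\mu(|g|>t)^{1/p}$, and let $L_{p,\infty}(G_m)$ be the space of measurable functions $g:G_m\to\mathbb C$ with $\|g\|_{L_{p,\infty}}<\infty$. Where a martingale $f$ is compared with functions in $L_{p,\infty}$, it stands for its almost everywhere limit $f_\infty=\lim_n f_n$; that this limit exists almost everywhere and lies in $L_{p,\infty}(G_m)$ is part of the claims below. Theorem 3. Let $0<p<1$. (a) Suppose that the sequence $m$ is bounded, that $f\in H_p(G_m)$, and that $$\omega\left(\tfrac1{M_n},f\right)_{H_p}=o\left(\frac1{M_n^{1/p-1}}\right)\quad\text{as } n\to\infty .$$ Then $\|S_kf-f\|_{L_{p,\infty}}\to0$ as $k\to\infty$. (b) For every sequence $m$ as above there is a martingale $f\in H_p(G_m)$ with $$\omega\left(\tfrac1{M_{2n}},f\right)_{H_p}=O\left(\frac1{M_{2n}^{1/p-1}}\right)\quad\text{as } n\to\infty$$ for which $\|S_kf-f\|_{L_{p,\infty}}\not\to0$ as $k\to\infty$. -/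

import Mathlib

open MeasureTheory Filter Topology
open scoped ENNReal NNReal ComplexConjugate

namespace Vilenkin

/-- The Vilenkin group `G_m`: the complete direct product of the cyclic groups `Z_{m_k}`. -/
abbrev Gm (m : ℕ → ℕ) : Type := (k : ℕ) → ZMod (m k)

/-- The measure on `Z_{m_k}` that gives mass `1 / m_k` to every point. -/
noncomputable def coordMeasure (m : ℕ → ℕ) (k : ℕ) : Measure (ZMod (m k)) :=
  ((m k : ℝ≥0∞)⁻¹) • Measure.count

/-- The normalized Haar measure on `G_m`, the product of the measures on the coordinates. -/
noncomputable def haar (m : ℕ → ℕ) : Measure (Gm m) :=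
  Measure.infinitePi (coordMeasure m)

/-- The generalized powers `M_0 = 1`, `M_{k+1} = m_k M_k`. -/
def M (m : ℕ → ℕ) (n : ℕ) : ℕ := ∏ k ∈ Finset.range n, m k

/-- The interval `I_n(x)` of the points that agree with `x` in the coordinates `0, …, n-1`. -/
def interval (m : ℕ → ℕ) (n : ℕ) (x : Gm m) : Set (Gm m) := {y | ∀ i < n, y i = x i}

theorem measurableSet_interval (m : ℕ → ℕ) (n : ℕ) (x : Gm m) :
    MeasurableSet (interval m n x) := by
  have h : interval m n x = ⋂ i : ℕ, ⋂ _ : i < n, (fun y : Gm m => y i) ⁻¹' {x i} := by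
    ext y
    simp [interval]
  rw [h]
  refine MeasurableSet.iInter fun i => MeasurableSet.iInter fun _ => ?_
  exact measurable_pi_apply i (MeasurableSet.singleton _)

theorem interval_eq_iUnion (m : ℕ → ℕ) (n : ℕ) (x : Gm m) :
    interval m n x = ⋃ a : ZMod (m n), interval m (n + 1) (Function.update x n a) := by
  ext y
  simp only [interval, Set.mem_ofPred_eq, Set.mem_iUnion]
  constructor
  · intro h
    refine ⟨y n, fun i hi => ?_⟩
    rcases eq_or_ne i n with rfl | hne
    · simp
    · rw [Function.update_of_ne hne]
      exact h i (by omega)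
  · rintro ⟨a, h⟩ i hi
    have := h i (by omega)
    rwa [Function.update_of_ne (by omega)] at this

/-- The filtration `(F_n)`: `F_n` is the `σ`-algebra generated by the intervals `I_n(x)`. -/
def filtration (m : ℕ → ℕ) : Filtration ℕ (inferInstance : MeasurableSpace (Gm m)) where
  seq n := MeasurableSpace.generateFrom {s | ∃ x : Gm m, s = interval m n x}
  mono' := by
    refine monotone_nat_of_le_succ fun n => ?_
    refine MeasurableSpace.generateFrom_le ?_
    rintro s ⟨x, rfl⟩
    rw [interval_eq_iUnion]
    have : Countable (ZMod (m n)) := by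
      rcases m n with _ | k
      · exact inferInstanceAs (Countable ℤ)
      · exact inferInstanceAs (Countable (Fin (k + 1)))
    exact MeasurableSet.iUnion fun a => MeasurableSpace.measurableSet_generateFrom ⟨_, rfl⟩
  le' n := by
    refine MeasurableSpace.generateFrom_le ?_
    rintro s ⟨x, rfl⟩
    exact measurableSet_interval m n x

/-- The digit `n_j` of `n` in the number system based on `m`: `n = ∑ n_j M_j`,
`0 ≤ n_j < m_j`. -/
def digit (m : ℕ → ℕ) (n j : ℕ) : ℕ := n / M m j % m j

/-- The generalized Rademacher functions `r_k(x) = exp (2 π i x_k / m_k)`. -/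
noncomputable def rademacher (m : ℕ → ℕ) (k : ℕ) (x : Gm m) : ℂ :=
  Complex.exp (2 * Real.pi * Complex.I * ((x k).val : ℂ) / (m k : ℂ))

/-- The Vilenkin functions `ψ_n = ∏_k r_k ^ {n_k}`; all but finitely many factors are `1`. -/
noncomputable def psi (m : ℕ → ℕ) (n : ℕ) (x : Gm m) : ℂ :=
  ∏ᶠ k : ℕ, rademacher m k x ^ digit m n k

/-- The Vilenkin-Fourier coefficients of an integrable function. -/
noncomputable def fourierCoeff (m : ℕ → ℕ) (g : Gm m → ℂ) (i : ℕ) : ℂ :=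
  ∫ x, g x * conj (psi m i x) ∂(haar m)

/-- The partial sums `S_n g = ∑_{k<n} ĝ(k) ψ_k` of an integrable function. -/
noncomputable def partialSum (m : ℕ → ℕ) (g : Gm m → ℂ) (n : ℕ) (x : Gm m) : ℂ :=
  ∑ k ∈ Finset.range n, fourierCoeff m g k * psi m k x

/-- The Vilenkin-Fourier coefficients of a martingale, `lim_k ∫ f_k conj(ψ_i)`
(the sequence is eventually constant for every martingale). -/
noncomputable def martCoeff (m : ℕ → ℕ) (f : ℕ → Gm m → ℂ) (i : ℕ) : ℂ :=
  limUnder atTop (fun k => fourierCoeff m (f k) i)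

/-- The partial sums `S_n f = ∑_{k<n} f̂(k) ψ_k` of the Vilenkin-Fourier series of a
martingale. -/
noncomputable def martPartialSum (m : ℕ → ℕ) (f : ℕ → Gm m → ℂ) (n : ℕ) (x : Gm m) : ℂ :=
  ∑ k ∈ Finset.range n, martCoeff m f k * psi m k x

/-- The maximal function `f^* = sup_n |f_n|`. -/
noncomputable def maximalFunction {m : ℕ → ℕ} (f : ℕ → Gm m → ℂ) (x : Gm m) : ℝ≥0∞ :=
  ⨆ n, ‖f n x‖ₑ

/-- The `H_p` (quasi-)norm `‖f‖_{H_p} = ‖f^*‖_p`, with values in `[0, ∞]`. -/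
noncomputable def hpNorm (m : ℕ → ℕ) (p : ℝ) (f : ℕ → Gm m → ℂ) : ℝ≥0∞ :=
  (∫⁻ x, maximalFunction f x ^ p ∂(haar m)) ^ (1 / p)

/-- Membership in the martingale Hardy space `H_p(G_m)`. -/
def MemHp (m : ℕ → ℕ) (p : ℝ) (f : ℕ → Gm m → ℂ) : Prop :=
  Martingale f (filtration m) (haar m) ∧ hpNorm m p f < ∞

/-- The modulus of continuity `ω(1/M_n, f)_{H_p} = ‖f - S_{M_n} f‖_{H_p}`, where
`f - S_{M_n} f` is the martingale `(f_k - S_{M_n} f_k)_k`. -/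
noncomputable def modulus (m : ℕ → ℕ) (p : ℝ) (f : ℕ → Gm m → ℂ) (n : ℕ) : ℝ≥0∞ :=
  hpNorm m p (fun k x => f k x - partialSum m (f k) (M m n) x)

/-- The weak-`L_p` (quasi-)norm `sup_{t>0} t μ(|g| > t)^{1/p}`, with values in `[0, ∞]`. -/
noncomputable def weakLpNorm (m : ℕ → ℕ) (p : ℝ) (g : Gm m → ℂ) : ℝ≥0∞ :=
  ⨆ (t : ℝ≥0) (_ : 0 < t), (t : ℝ≥0∞) * haar m {x | (t : ℝ≥0∞) < ‖g x‖ₑ} ^ (1 / p)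

/-- Membership in the space `L_{p,∞}(G_m)`. -/
def MemWeakLp (m : ℕ → ℕ) (p : ℝ) (g : Gm m → ℂ) : Prop :=
  Measurable g ∧ weakLpNorm m p g < ∞

/-- The function `F` is the almost everywhere limit of the martingale `f`. -/
def IsLimitFunction (m : ℕ → ℕ) (f : ℕ → Gm m → ℂ) (F : Gm m → ℂ) : Prop :=
  ∀ᵐ x ∂(haar m), Tendsto (fun n => f n x) atTop (𝓝 (F x))

end Vilenkin

/-! Part (a). For `M_n ≤ k ≤ M_{n+1}` the partial sum satisfies
`S_k f - f_n = S_k (f_{n+1} - f_n)`, and the difference `f_{n+1} - f_n` is constant on the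
intervals of rank `n + 1`. The kernel `D_k(x - t)` of `S_k` is at most `M_{s+1}` when `x` and `t`
first differ in the coordinate `s`, so for `p < 1` and bounded `m` its `L_p` quasinorm in `x` is
bounded uniformly in `k` and `t`. Since a function `h` constant on the intervals of rank `n`
satisfies `(∫ |h|)^p ≤ M_n^{1-p} ∫ |h|^p`, the operator `S_k` increases the `L_p` quasinorm of an
`F_{n+1}`-measurable function by a factor of order at most `M_{n+1}^{1/p-1}`, which is exactly what
the assumption on the modulus of continuity absorbs. The convergence thus holds even in `L_p`.

Part (b). The martingale `f = ∑_j r_j D_{M_j}` has `|r_j D_{M_j}| = M_j` on `I_j(0)` and `0`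
elsewhere, so the `p`-th power of the maximal function of its `n`-th tail has integral at most
`∑_{j ≥ n} M_j^{p-1}`, of order `M_n^{p-1}`. Its coefficient at `M_j` is `1` for every `j`, so
`S_{M_j + 1} f - S_{M_j} f` has modulus `1` everywhere and `S_k f` cannot converge in `L_{p,∞}`. -/

namespace Vilenkin

variable {m : ℕ → ℕ}

section Digits

theorem M_zero : M m 0 = 1 := by simp [M]

theorem M_succ (n : ℕ) : M m (n + 1) = M m n * m n := Finset.prod_range_succ _ _

theorem M_dvd_M {k n : ℕ} (h : k ≤ n) : M m k ∣ M m n :=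
  Finset.prod_dvd_prod_of_subset _ _ _ (Finset.range_mono h)

theorem natCast_M_succ_le {b : ℕ} (hb : ∀ k, m k ≤ b) (n : ℕ) :
    (M m (n + 1) : ℝ≥0∞) ≤ b * M m n := by
  rw [M_succ, mul_comm]
  exact_mod_cast Nat.mul_le_mul_right _ (hb n)

theorem digit_eq_mod_div (i k : ℕ) : digit m i k = i % M m (k + 1) / M m k := by
  rw [M_succ, Nat.mod_mul_right_div_self, digit]

theorem digit_mul_M_add_of_lt {n k : ℕ} (hk : k < n) (q j : ℕ) :
    digit m (q * M m n + j) k = digit m j k := by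
  obtain ⟨c, hc⟩ := M_dvd_M (m := m) (Nat.succ_le_of_lt hk)
  rw [digit_eq_mod_div, digit_eq_mod_div, hc, Nat.succ_eq_add_one,
    show q * (M m (k + 1) * c) + j = j + M m (k + 1) * (q * c) by ring, Nat.add_mul_mod_self_left]

section NeZero

variable [∀ k, NeZero (m k)]

theorem M_pos (n : ℕ) : 0 < M m n :=
  Finset.prod_pos fun k _ => Nat.pos_of_ne_zero (NeZero.ne (m k))

theorem M_mono : Monotone (M m) := fun _ _ h => Nat.le_of_dvd (M_pos _) (M_dvd_M h)

theorem natCast_M_ne_zero (n : ℕ) : (M m n : ℝ≥0∞) ≠ 0 := Nat.cast_ne_zero.2 (M_pos n).ne'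

theorem one_le_M_rpow {a : ℝ} (ha : 0 ≤ a) (n : ℕ) : 1 ≤ (M m n : ℝ≥0∞) ^ a := by
  have hM : (1 : ℝ≥0∞) ≤ M m n := by exact_mod_cast M_pos (m := m) n
  simpa using ENNReal.rpow_le_rpow hM ha

theorem ofReal_M_rpow (n : ℕ) (a : ℝ) :
    ENNReal.ofReal ((M m n : ℝ) ^ a) = (M m n : ℝ≥0∞) ^ a := by
  rw [← ENNReal.ofReal_rpow_of_pos (by exact_mod_cast M_pos n), ENNReal.ofReal_natCast]

theorem mul_M_lt_M_succ {n a : ℕ} (ha : a < m n) : a * M m n < M m (n + 1) := by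
  rw [M_succ, mul_comm]
  exact Nat.mul_lt_mul_of_pos_left ha (M_pos n)

theorem digit_eq_zero {i n k : ℕ} (hi : i < M m n) (hk : n ≤ k) : digit m i k = 0 := by
  rw [digit, Nat.div_eq_of_lt (hi.trans_le (M_mono hk)), Nat.zero_mod]

theorem digit_mul_M_add {n j : ℕ} (hj : j < M m n) (q k : ℕ) :
    digit m (q * M m n + j) k = digit m (q * M m n) k + digit m j k := by
  rcases lt_or_ge k n with hk | hk
  · have hq := digit_mul_M_add_of_lt (m := m) hk q 0
    rw [digit_mul_M_add_of_lt hk, ← add_zero (q * M m n), hq]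
    simp [digit]
  · obtain ⟨c, hc⟩ := M_dvd_M (m := m) hk
    rw [digit_eq_zero hj hk, add_zero, digit, digit, hc, ← Nat.div_div_eq_div_mul,
      ← Nat.div_div_eq_div_mul, mul_comm q, Nat.mul_add_div (M_pos n), Nat.div_eq_of_lt hj,
      Nat.mul_div_cancel_left _ (M_pos n), add_zero]

theorem digit_mul_M {n a : ℕ} (ha : a < m n) (k : ℕ) :
    digit m (a * M m n) k = if k = n then a else 0 := by
  rcases lt_trichotomy k n with hk | rfl | hk
  · rw [if_neg hk.ne, ← add_zero (a * M m n), digit_mul_M_add_of_lt hk]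
    simp [digit]
  · rw [if_pos rfl, digit, Nat.mul_div_cancel _ (M_pos k), Nat.mod_eq_of_lt ha]
  · rw [if_neg hk.ne', digit_eq_zero (mul_M_lt_M_succ ha) hk]

end NeZero

section AtLeastTwo

variable [∀ k, (m k).AtLeastTwo]

theorem M_mul_two_pow_le (n j : ℕ) : M m n * 2 ^ j ≤ M m (n + j) := by
  induction j with
  | zero => simp
  | succ j ih =>
    rw [pow_succ, ← mul_assoc, ← add_assoc, M_succ]
    exact Nat.mul_le_mul ih Nat.AtLeastTwo.prop

theorem lt_M (n : ℕ) : n < M m n :=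
  calc n < 2 ^ n := Nat.lt_two_pow_self
    _ ≤ M m n := by simpa [M_zero] using M_mul_two_pow_le (m := m) 0 n

theorem M_strictMono : StrictMono (M m) :=
  strictMono_nat_of_lt_succ fun n => by
    simpa using mul_M_lt_M_succ (m := m) (n := n) (a := 1) Nat.AtLeastTwo.prop

theorem tendsto_M_atTop : Tendsto (M m) atTop atTop := M_strictMono.tendsto_atTop

theorem tendsto_M_rpow_of_neg {a : ℝ} (ha : a < 0) :
    Tendsto (fun n => (M m n : ℝ≥0∞) ^ a) atTop (𝓝 0) := by
  have h : Tendsto (fun n => (M m n : ℝ≥0∞)) atTop (𝓝 ∞) :=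
    ENNReal.tendsto_nat_nhds_top.comp tendsto_M_atTop
  simpa [ENNReal.top_rpow_of_neg ha] using h.ennrpow_const a

theorem tendsto_zero_of_forall_M_le {a u : ℕ → ℝ≥0∞} (hu : Tendsto u atTop (𝓝 0))
    (h : ∀ n k, M m n ≤ k → k ≤ M m (n + 1) → a k ≤ u n) : Tendsto a atTop (𝓝 0) := by
  refine ENNReal.tendsto_nhds_zero.2 fun ε hε => ?_
  obtain ⟨N, hN⟩ := eventually_atTop.1 (ENNReal.tendsto_nhds_zero.1 hu ε hε)
  filter_upwards [eventually_gt_atTop (M m N)] with k hk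
  obtain ⟨n, hnk, hkn⟩ := M_strictMono.exists_between_of_tendsto_atTop tendsto_M_atTop
    ((M_mono N.zero_le).trans_lt hk)
  have hNn : N ≤ n := Nat.lt_succ_iff.1 (M_strictMono.lt_iff_lt.1 (hk.trans_le hkn))
  exact (h n k hnk.le hkn).trans (hN n hNn)

end AtLeastTwo

end Digits

section Characters

theorem psi_apply_zero (i : ℕ) : psi m i 0 = 1 := by
  simp [psi, rademacher]

variable [∀ k, NeZero (m k)]

theorem rademacher_eq_stdAddChar (k : ℕ) (x : Gm m) :
    rademacher m k x = ZMod.stdAddChar (x k) := by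
  rw [rademacher, ZMod.stdAddChar_apply, ZMod.toCircle_apply]

theorem norm_rademacher (k : ℕ) (x : Gm m) : ‖rademacher m k x‖ = 1 := by
  rw [rademacher_eq_stdAddChar, AddChar.norm_apply]

theorem norm_psi (i : ℕ) (x : Gm m) : ‖psi m i x‖ = 1 :=
  finprod_induction (‖·‖ = 1) norm_one (fun _ _ ha hb => by rw [norm_mul, ha, hb, one_mul])
    fun k => by rw [norm_pow, norm_rademacher, one_pow]

theorem psi_mul_conj_psi (i : ℕ) (x : Gm m) : psi m i x * conj (psi m i x) = 1 := by
  simp [Complex.mul_conj, Complex.normSq_eq_norm_sq, norm_psi]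

theorem psi_eq_prod {i n : ℕ} (hi : i < M m n) (x : Gm m) :
    psi m i x = ∏ k ∈ Finset.range n, rademacher m k x ^ digit m i k := by
  refine finprod_eq_prod_of_mulSupport_subset _ fun k hk => ?_
  by_contra hkn
  simp only [Finset.coe_range, Set.mem_Iio, not_lt] at hkn
  exact hk (by simp [digit_eq_zero hi hkn])

theorem psi_congr {i n : ℕ} (hi : i < M m n) {x y : Gm m} (h : y ∈ interval m n x) :
    psi m i y = psi m i x := by
  rw [psi_eq_prod hi, psi_eq_prod hi]
  refine Finset.prod_congr rfl fun k hk => ?_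
  rw [rademacher, rademacher, h k (Finset.mem_range.1 hk)]

theorem psi_mul_M {n a : ℕ} (ha : a < m n) (x : Gm m) :
    psi m (a * M m n) x = rademacher m n x ^ a := by
  rw [psi_eq_prod (mul_M_lt_M_succ ha)]
  simp [digit_mul_M ha, pow_ite]

theorem sum_psi_mul_M_eq_zero {n : ℕ} {x t : Gm m} (h : x n ≠ t n) :
    ∑ a ∈ Finset.range (m n), psi m (a * M m n) x * conj (psi m (a * M m n) t) = 0 := by
  set z : ℂ := ZMod.stdAddChar (x n - t n) with hz
  have hterm : ∀ a ∈ Finset.range (m n),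
      psi m (a * M m n) x * conj (psi m (a * M m n) t) = z ^ a := fun a ha => by
    rw [psi_mul_M (Finset.mem_range.1 ha), psi_mul_M (Finset.mem_range.1 ha), map_pow, ← mul_pow,
      rademacher_eq_stdAddChar, rademacher_eq_stdAddChar, ← AddChar.map_neg_eq_conj,
      ← AddChar.map_add_eq_mul, ← sub_eq_add_neg]
  have hz_ne : z ≠ 1 := fun hz1 => h <| sub_eq_zero.1 <|
    ZMod.injective_stdAddChar (hz1.trans (AddChar.map_zero_eq_one _).symm)
  have hz_pow : z ^ m n = 1 := by
    rw [hz, ← AddChar.map_nsmul_eq_pow]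
    simp
  rw [Finset.sum_congr rfl hterm, geom_sum_eq hz_ne, hz_pow, sub_self, zero_div]

end Characters

section AtLeastTwoCharacters

variable [∀ k, (m k).AtLeastTwo]

theorem psi_mul_M_add {n j : ℕ} (hj : j < M m n) (q : ℕ) (x : Gm m) :
    psi m (q * M m n + j) x = psi m (q * M m n) x * psi m j x := by
  have hN : q * M m n + j < M m (q * M m n + j) := lt_M _
  rw [psi_eq_prod hN, psi_eq_prod ((Nat.le_add_right _ _).trans_lt hN),
    psi_eq_prod ((Nat.le_add_left _ _).trans_lt hN), ← Finset.prod_mul_distrib]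
  simp only [digit_mul_M_add hj, pow_add]

end AtLeastTwoCharacters

/-- The kernel `∑_{i<k} ψ_i(x) conj ψ_i(t) = D_k(x - t)` of the operator `S_k`, where `D_k` is the
`k`-th Dirichlet kernel. -/
noncomputable def kernel (m : ℕ → ℕ) (k : ℕ) (x t : Gm m) : ℂ :=
  ∑ i ∈ Finset.range k, psi m i x * conj (psi m i t)

section Kernel

section NeZero

variable [∀ k, NeZero (m k)]

theorem norm_kernel_le (k : ℕ) (x t : Gm m) : ‖kernel m k x t‖ ≤ k := by
  refine (norm_sum_le _ _).trans ?_
  simp [norm_psi]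

theorem kernel_congr_right {k n : ℕ} (hk : k ≤ M m n) (x : Gm m) {s t : Gm m}
    (h : t ∈ interval m n s) : kernel m k x t = kernel m k x s :=
  Finset.sum_congr rfl fun i hi => by
    rw [psi_congr ((Finset.mem_range.1 hi).trans_le hk) h]

theorem kernel_M_of_mem {n : ℕ} {x t : Gm m} (h : x ∈ interval m n t) :
    kernel m (M m n) x t = M m n := by
  have hterm : ∀ i ∈ Finset.range (M m n), psi m i x * conj (psi m i t) = 1 := fun i hi => by
    rw [psi_congr (Finset.mem_range.1 hi) h, psi_mul_conj_psi]
  simp [kernel, Finset.sum_congr rfl hterm]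

end NeZero

variable [∀ k, (m k).AtLeastTwo]

theorem kernel_mul_M_add (q n : ℕ) {j : ℕ} (hj : j ≤ M m n) (x t : Gm m) :
    kernel m (q * M m n + j) x t = kernel m (q * M m n) x t +
      psi m (q * M m n) x * conj (psi m (q * M m n) t) * kernel m j x t := by
  simp only [kernel, Finset.sum_range_add, Finset.mul_sum]
  congr 1
  refine Finset.sum_congr rfl fun i hi => ?_
  have hi : i < M m n := (Finset.mem_range.1 hi).trans_le hj
  rw [psi_mul_M_add hi, psi_mul_M_add hi, map_mul]
  ring

theorem kernel_mul_M (q n : ℕ) (x t : Gm m) :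
    kernel m (q * M m n) x t =
      (∑ a ∈ Finset.range q, psi m (a * M m n) x * conj (psi m (a * M m n) t)) *
        kernel m (M m n) x t := by
  induction q with
  | zero => simp [kernel]
  | succ q ih =>
    rw [add_mul, one_mul, kernel_mul_M_add q n le_rfl, ih, Finset.sum_range_succ, add_mul]

theorem kernel_M_of_notMem {n : ℕ} {x t : Gm m} (h : x ∉ interval m n t) :
    kernel m (M m n) x t = 0 := by
  induction n with
  | zero => exact absurd (fun _ hi => absurd hi (Nat.not_lt_zero _)) h
  | succ n ih =>
    rw [M_succ, mul_comm, kernel_mul_M]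
    by_cases hn : x ∈ interval m n t
    · have hxn : x n ≠ t n := fun hxn => h fun i hi =>
        (Nat.lt_succ_iff_lt_or_eq.1 hi).elim (hn i) fun hin => hin ▸ hxn
      rw [sum_psi_mul_M_eq_zero hxn, zero_mul]
    · rw [ih hn, mul_zero]

theorem norm_kernel_le_of_notMem (k : ℕ) {n : ℕ} {x t : Gm m} (h : x ∉ interval m n t) :
    ‖kernel m k x t‖ ≤ M m n := by
  have hlt : k % M m n < M m n := Nat.mod_lt _ (M_pos n)
  calc ‖kernel m k x t‖ = ‖kernel m (k % M m n) x t‖ := by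
        nth_rw 1 [← Nat.div_add_mod' k (M m n)]
        simp [kernel_mul_M_add _ _ hlt.le, kernel_mul_M, kernel_M_of_notMem h, norm_psi]
    _ ≤ M m n := (norm_kernel_le _ _ _).trans (Nat.cast_le.2 hlt.le)

theorem exists_mem_interval_norm_kernel_le (k : ℕ) (x t : Gm m) :
    ∃ s, x ∈ interval m s t ∧ ‖kernel m k x t‖ ≤ M m (s + 1) := by
  classical
  by_cases h : ∃ s, x s ≠ t s
  · exact ⟨Nat.find h, fun i hi => not_not.1 (Nat.find_min h hi), norm_kernel_le_of_notMem k
      fun hx => Nat.find_spec h (hx _ (Nat.lt_succ_self _))⟩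
  · push Not at h
    exact ⟨k, fun i _ => h i, (norm_kernel_le k x t).trans
      (Nat.cast_le.2 (k.le_succ.trans (lt_M _).le))⟩

end Kernel

section Haar

theorem coordMeasure_singleton (k : ℕ) (a : ZMod (m k)) :
    coordMeasure m k {a} = (m k : ℝ≥0∞)⁻¹ := by
  simp [coordMeasure]

variable [∀ k, NeZero (m k)]

instance isProbabilityMeasure_coordMeasure (k : ℕ) : IsProbabilityMeasure (coordMeasure m k) where
  measure_univ := by
    have h : (m k : ℝ≥0∞) ≠ 0 := Nat.cast_ne_zero.2 (NeZero.ne _)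
    simp [coordMeasure, Measure.count_apply, ENNReal.inv_mul_cancel h]

instance isProbabilityMeasure_haar : IsProbabilityMeasure (haar m) := by
  unfold haar; infer_instance

theorem haar_interval (n : ℕ) (x : Gm m) : haar m (interval m n x) = (M m n : ℝ≥0∞)⁻¹ := by
  have h : interval m n x = Set.pi (Finset.range n : Set ℕ) fun k => {x k} := by
    ext y; simp [interval]
  rw [h, haar, Measure.infinitePi_pi _ fun _ _ => MeasurableSet.singleton _]
  simp only [coordMeasure_singleton]
  rw [M, Nat.cast_prod, ENNReal.prod_inv_distrib]
  simp [Set.Pairwise]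

end Haar

section Filtration

theorem mem_interval_self (n : ℕ) (x : Gm m) : x ∈ interval m n x := fun _ _ => rfl

theorem mem_interval_comm {n : ℕ} {x y : Gm m} : x ∈ interval m n y ↔ y ∈ interval m n x :=
  ⟨fun h i hi => (h i hi).symm, fun h i hi => (h i hi).symm⟩

theorem interval_eq_of_mem {n : ℕ} {x y : Gm m} (h : y ∈ interval m n x) :
    interval m n y = interval m n x :=
  Set.ext fun _ => ⟨fun hz i hi => (hz i hi).trans (h i hi),
    fun hz i hi => (hz i hi).trans (h i hi).symm⟩

theorem measurableSet_filtration_interval (n : ℕ) (x : Gm m) :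
    MeasurableSet[filtration m n] (interval m n x) :=
  MeasurableSpace.measurableSet_generateFrom ⟨x, rfl⟩

theorem measurable_of_stronglyMeasurable_filtration {n : ℕ} {g : Gm m → ℂ}
    (hg : StronglyMeasurable[filtration m n] g) : Measurable g :=
  (hg.mono ((filtration m).le n)).measurable

variable [∀ k, NeZero (m k)]

theorem finite_range_interval (n : ℕ) : (Set.range (interval m n)).Finite := by
  refine (Set.finite_range fun a : (i : Fin n) → ZMod (m i) =>
    {y : Gm m | ∀ i : Fin n, y i = a i}).subset ?_
  rintro _ ⟨x, rfl⟩
  exact ⟨fun i => x i, Set.ext fun y => ⟨fun h i hi => h ⟨i, hi⟩, fun h i => h i i.2⟩⟩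

theorem measurableSet_filtration_iff {n : ℕ} {s : Set (Gm m)} :
    MeasurableSet[filtration m n] s ↔ ∀ x y, y ∈ interval m n x → (y ∈ s ↔ x ∈ s) := by
  refine ⟨fun hs x y h => ?_, fun hs => ?_⟩
  · induction s, hs using MeasurableSpace.generateFrom_induction with
    | hC t ht =>
      obtain ⟨z, rfl⟩ := ht
      rw [mem_interval_comm, mem_interval_comm (x := x), interval_eq_of_mem h]
    | empty => rfl
    | compl t _ ht => exact not_congr ht
    | iUnion t _ ht => simp only [Set.mem_iUnion, ht]
  · have hunion : s = ⋃₀ {t | t ∈ Set.range (interval m n) ∧ t ⊆ s} := by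
      refine Set.ext fun x => ⟨fun hx => ?_, fun ⟨t, ht, hx⟩ => ht.2 hx⟩
      exact ⟨_, ⟨⟨x, rfl⟩, fun y hy => (hs x y hy).2 hx⟩, mem_interval_self n x⟩
    rw [hunion]
    refine MeasurableSet.sUnion ((finite_range_interval n).countable.mono fun t ht => ht.1) ?_
    rintro _ ⟨⟨x, rfl⟩, _⟩
    exact measurableSet_filtration_interval n x

theorem stronglyMeasurable_filtration_iff {n : ℕ} {g : Gm m → ℂ} :
    StronglyMeasurable[filtration m n] g ↔ ∀ x y, y ∈ interval m n x → g y = g x := by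
  refine ⟨fun hg x y h => ?_, fun hg => ?_⟩
  · have hlevel := hg.measurable (MeasurableSet.singleton (g x))
    exact (measurableSet_filtration_iff.1 hlevel x y h).2 rfl
  · have hmeas : Measurable[filtration m n] g := fun s _ =>
      measurableSet_filtration_iff.2 fun x y h => by
        rw [Set.mem_preimage, Set.mem_preimage, hg x y h]
    exact hmeas.stronglyMeasurable

theorem integrable_of_stronglyMeasurable_filtration {n : ℕ} {g : Gm m → ℂ}
    (hg : StronglyMeasurable[filtration m n] g) : Integrable g (haar m) := by
  have hfac : g.FactorsThrough (interval m n) := fun x y h =>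
    stronglyMeasurable_filtration_iff.1 hg y x (h ▸ mem_interval_self n x)
  have hfin : (Set.range g).Finite := by
    rw [show g = Function.extend (interval m n) g 0 ∘ interval m n from
      funext fun x => (hfac.extend_apply 0 x).symm, Set.range_comp]
    exact (finite_range_interval n).image _
  exact SimpleFunc.integrable_of_isFiniteMeasure ⟨g, fun a =>
    measurable_of_stronglyMeasurable_filtration hg (MeasurableSet.singleton a), hfin⟩

end Filtration

section Fourier

theorem conj_fourierCoeff_psi (i j : ℕ) :
    conj (fourierCoeff m (psi m i) j) = fourierCoeff m (psi m j) i := by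
  simp only [fourierCoeff, ← integral_conj, map_mul, Complex.conj_conj, mul_comm]

theorem fourierCoeff_const_mul (c : ℂ) (g : Gm m → ℂ) (i : ℕ) :
    fourierCoeff m (fun x => c * g x) i = c * fourierCoeff m g i := by
  simp only [fourierCoeff, mul_assoc, integral_const_mul]

theorem stronglyMeasurable_filtration_psi [∀ k, NeZero (m k)] {i n : ℕ} (hi : i < M m n) :
    StronglyMeasurable[filtration m n] (psi m i) :=
  stronglyMeasurable_filtration_iff.2 fun _ _ h => psi_congr hi h

variable [∀ k, (m k).AtLeastTwo]

theorem measurable_psi (i : ℕ) : Measurable (psi m i) :=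
  measurable_of_stronglyMeasurable_filtration (stronglyMeasurable_filtration_psi (lt_M i))

theorem integrable_psi (i : ℕ) : Integrable (psi m i) (haar m) :=
  integrable_of_stronglyMeasurable_filtration (stronglyMeasurable_filtration_psi (lt_M i))

theorem integrable_mul_conj_psi {g : Gm m → ℂ} (hg : Integrable g (haar m)) (i : ℕ) :
    Integrable (fun x => g x * conj (psi m i x)) (haar m) :=
  hg.mul_bdd (c := 1)
    (Complex.continuous_conj.measurable.comp (measurable_psi i)).aestronglyMeasurable
    (ae_of_all _ fun x => by simp [norm_psi])

theorem fourierCoeff_sub {g h : Gm m → ℂ} (hg : Integrable g (haar m))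
    (hh : Integrable h (haar m)) (i : ℕ) :
    fourierCoeff m (fun x => g x - h x) i = fourierCoeff m g i - fourierCoeff m h i := by
  simp only [fourierCoeff, sub_mul]
  exact integral_sub (integrable_mul_conj_psi hg i) (integrable_mul_conj_psi hh i)

theorem fourierCoeff_sum {ι : Type*} (s : Finset ι) {g : ι → Gm m → ℂ}
    (hg : ∀ a ∈ s, Integrable (g a) (haar m)) (i : ℕ) :
    fourierCoeff m (fun x => ∑ a ∈ s, g a x) i = ∑ a ∈ s, fourierCoeff m (g a) i := by
  simp only [fourierCoeff, Finset.sum_mul]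
  exact integral_finsetSum _ fun a ha => integrable_mul_conj_psi (hg a ha) i

theorem partialSum_sub {g h : Gm m → ℂ} (hg : Integrable g (haar m))
    (hh : Integrable h (haar m)) (k : ℕ) (x : Gm m) :
    partialSum m (fun y => g y - h y) k x = partialSum m g k x - partialSum m h k x := by
  simp only [partialSum, fourierCoeff_sub hg hh, sub_mul, Finset.sum_sub_distrib]

theorem partialSum_eq_integral {g : Gm m → ℂ} (hg : Integrable g (haar m)) (k : ℕ) (x : Gm m) :
    partialSum m g k x = ∫ t, g t * kernel m k x t ∂haar m := by
  have hterm : ∀ i t, g t * (psi m i x * conj (psi m i t)) =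
      g t * conj (psi m i t) * psi m i x := fun i t => by ring
  simp only [partialSum, kernel, fourierCoeff, Finset.mul_sum, hterm]
  rw [integral_finsetSum _ fun i _ => (integrable_mul_conj_psi hg i).mul_const _]
  simp only [integral_mul_const]

theorem partialSum_M_eq_setIntegral {g : Gm m → ℂ} (hg : Integrable g (haar m)) (n : ℕ)
    (x : Gm m) : partialSum m g (M m n) x = M m n * ∫ t in interval m n x, g t ∂haar m := by
  rw [partialSum_eq_integral hg, ← integral_indicator (measurableSet_interval m n x),
    ← integral_const_mul]
  refine integral_congr_ae (ae_of_all _ fun t => ?_)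
  by_cases h : t ∈ interval m n x
  · simp [h, kernel_M_of_mem (mem_interval_comm.1 h), mul_comm]
  · simp [h, kernel_M_of_notMem (mt mem_interval_comm.1 h)]

theorem partialSum_M_of_stronglyMeasurable {g : Gm m → ℂ} {n : ℕ}
    (hg : StronglyMeasurable[filtration m n] g) : partialSum m g (M m n) = g := by
  ext x
  rw [partialSum_M_eq_setIntegral (integrable_of_stronglyMeasurable_filtration hg),
    setIntegral_congr_fun (g := fun _ => g x) (measurableSet_interval m n x)
      (stronglyMeasurable_filtration_iff.1 hg x), setIntegral_const, Measure.real, haar_interval]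
  simp [(M_pos (m := m) n).ne']

theorem fourierCoeff_psi_self (i : ℕ) : fourierCoeff m (psi m i) i = 1 := by
  simp [fourierCoeff, psi_mul_conj_psi]

-- Orthogonality needs no integration: `ψ_i = S_{M_n} ψ_i` forces `∑_l ‖ψ̂_i(l)‖² = ψ̂_i(i) = 1`, so
-- every coefficient of `ψ_i` other than the `i`-th vanishes.
theorem sum_norm_fourierCoeff_psi_sq {i n : ℕ} (hi : i < M m n) :
    ∑ l ∈ Finset.range (M m n), ‖fourierCoeff m (psi m i) l‖ ^ 2 = 1 := by
  have hexpand := fourierCoeff_psi_self (m := m) i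
  nth_rw 1 [← partialSum_M_of_stronglyMeasurable (stronglyMeasurable_filtration_psi hi)] at hexpand
  unfold partialSum at hexpand
  rw [fourierCoeff_sum _ fun l _ => (integrable_psi l).const_mul _] at hexpand
  simp only [fourierCoeff_const_mul, ← conj_fourierCoeff_psi i, Complex.mul_conj,
    Complex.normSq_eq_norm_sq] at hexpand
  exact_mod_cast hexpand

theorem fourierCoeff_psi (i j : ℕ) : fourierCoeff m (psi m i) j = if i = j then 1 else 0 := by
  split_ifs with h
  · rw [h, fourierCoeff_psi_self]
  have hlt : ∀ l ∈ ({i, j} : Finset ℕ), l < M m (max i j) := by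
    simp [(le_max_left i j).trans_lt (lt_M _), (le_max_right i j).trans_lt (lt_M _)]
  have hsum := Finset.sum_le_sum_of_subset_of_nonneg
    (f := fun l => ‖fourierCoeff m (psi m i) l‖ ^ 2)
    (fun l hl => Finset.mem_range.2 (hlt l hl)) fun _ _ _ => by positivity
  rw [sum_norm_fourierCoeff_psi_sq (hlt i (by simp)), Finset.sum_pair h,
    fourierCoeff_psi_self] at hsum
  have hj : ‖fourierCoeff m (psi m i) j‖ ^ 2 ≤ 0 := by simpa using hsum
  simpa using hj.antisymm (by positivity)

theorem fourierCoeff_partialSum (g : Gm m → ℂ) (k i : ℕ) :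
    fourierCoeff m (partialSum m g k) i = if i < k then fourierCoeff m g i else 0 := by
  unfold partialSum
  rw [fourierCoeff_sum _ fun l _ => (integrable_psi l).const_mul _]
  simp [fourierCoeff_const_mul, fourierCoeff_psi]

theorem fourierCoeff_eq_zero {g : Gm m → ℂ} {n i : ℕ}
    (hg : StronglyMeasurable[filtration m n] g) (hi : M m n ≤ i) : fourierCoeff m g i = 0 := by
  rw [← partialSum_M_of_stronglyMeasurable hg, fourierCoeff_partialSum, if_neg hi.not_gt]

theorem partialSum_of_stronglyMeasurable {g : Gm m → ℂ} {n k : ℕ}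
    (hg : StronglyMeasurable[filtration m n] g) (hk : M m n ≤ k) : partialSum m g k = g := by
  nth_rw 2 [← partialSum_M_of_stronglyMeasurable hg]
  ext x
  refine (Finset.sum_subset (Finset.range_mono hk) fun i _ hi => ?_).symm
  rw [fourierCoeff_eq_zero hg (by simpa using hi), zero_mul]

end Fourier

section MartingaleFourier

variable [∀ k, (m k).AtLeastTwo] {f : ℕ → Gm m → ℂ}

theorem partialSum_M_martingale (hf : Martingale f (filtration m) (haar m)) (k n : ℕ) :
    partialSum m (f k) (M m n) = f (min k n) := by
  rcases le_total k n with h | h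
  · rw [min_eq_left h, partialSum_of_stronglyMeasurable (hf.1 k) (M_mono h)]
  · rw [min_eq_right h, ← partialSum_M_of_stronglyMeasurable (hf.1 n)]
    ext x
    rw [partialSum_M_eq_setIntegral (hf.integrable k),
      partialSum_M_eq_setIntegral (hf.integrable n),
      hf.setIntegral_eq h (measurableSet_filtration_interval n x)]

theorem martCoeff_eq (hf : Martingale f (filtration m) (haar m)) {n i : ℕ} (hi : i < M m n) :
    martCoeff m f i = fourierCoeff m (f n) i := by
  refine Tendsto.limUnder_eq (tendsto_const_nhds.congr' ?_)
  filter_upwards [eventually_ge_atTop n] with k hk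
  have hproj : partialSum m (f k) (M m n) = f n := by
    rw [partialSum_M_martingale hf, min_eq_right hk]
  rw [← hproj, fourierCoeff_partialSum, if_pos hi]

theorem martPartialSum_eq (hf : Martingale f (filtration m) (haar m)) {n k : ℕ}
    (hk : k ≤ M m n) : martPartialSum m f k = partialSum m (f n) k :=
  funext fun _ => Finset.sum_congr rfl fun i hi => by
    rw [martCoeff_eq hf ((Finset.mem_range.1 hi).trans_le hk)]

theorem martPartialSum_sub_eq (hf : Martingale f (filtration m) (haar m)) {n k : ℕ}
    (hn : M m n ≤ k) (hk : k ≤ M m (n + 1)) (x : Gm m) :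
    martPartialSum m f k x - f n x = partialSum m (fun y => f (n + 1) y - f n y) k x := by
  rw [martPartialSum_eq hf hk, partialSum_sub (hf.integrable _) (hf.integrable _),
    partialSum_of_stronglyMeasurable (hf.1 n) hn]

end MartingaleFourier

section Quasinorms

variable {p : ℝ}

theorem hpNorm_eq_eLpNorm' (f : ℕ → Gm m → ℂ) :
    hpNorm m p f = eLpNorm' (maximalFunction f) p (haar m) := rfl

theorem eLpNorm'_le_hpNorm (hp : 0 ≤ p) {f : ℕ → Gm m → ℂ} {g : Gm m → ℂ}
    (h : ∀ᵐ x ∂haar m, ‖g x‖ₑ ≤ maximalFunction f x) :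
    eLpNorm' g p (haar m) ≤ hpNorm m p f := by
  rw [hpNorm_eq_eLpNorm']
  exact eLpNorm'_mono_enorm_ae hp h

theorem weakLpNorm_le_eLpNorm' (hp : 0 < p) {g : Gm m → ℂ} (hg : AEMeasurable g (haar m)) :
    weakLpNorm m p g ≤ eLpNorm' g p (haar m) := by
  refine iSup₂_le fun t _ => (ENNReal.rpow_le_rpow_iff hp).1 ?_
  rw [ENNReal.mul_rpow_of_nonneg _ _ hp.le, one_div, ENNReal.rpow_inv_rpow hp.ne',
    ← lintegral_rpow_enorm_eq_rpow_eLpNorm' hp]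
  calc (t : ℝ≥0∞) ^ p * haar m {x | (t : ℝ≥0∞) < ‖g x‖ₑ}
      ≤ (t : ℝ≥0∞) ^ p * haar m {x | (t : ℝ≥0∞) ^ p ≤ ‖g x‖ₑ ^ p} := by
        gcongr with x
        exact fun hx => ENNReal.rpow_le_rpow hx.le hp.le
    _ ≤ ∫⁻ x, ‖g x‖ₑ ^ p ∂haar m := mul_meas_ge_le_lintegral₀ (hg.enorm.pow_const p) _

theorem rpow_lintegral_le_of_ae_rpow_le {α : Type*} {_ : MeasurableSpace α} {μ : Measure α}
    (hp0 : 0 < p) (hp1 : p ≤ 1) {h : α → ℝ≥0∞} (hh : AEMeasurable h μ) {c : ℝ≥0∞}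
    (hc : ∀ᵐ x ∂μ, h x ^ p ≤ c * ∫⁻ y, h y ^ p ∂μ) :
    (∫⁻ x, h x ∂μ) ^ p ≤ c ^ (1 - p) * ∫⁻ x, h x ^ p ∂μ := by
  set A := ∫⁻ x, h x ^ p ∂μ
  have hsub : 0 ≤ 1 - p := by linarith
  have hle : ∀ᵐ x ∂μ, h x ≤ h x ^ p * (c * A) ^ ((1 - p) / p) := hc.mono fun x hx =>
    calc h x = h x ^ (p + (1 - p)) := by simp
      _ = h x ^ p * (h x ^ p) ^ ((1 - p) / p) := by
        rw [ENNReal.rpow_add_of_nonneg _ _ hp0.le hsub, ← ENNReal.rpow_mul,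
          mul_div_cancel₀ _ hp0.ne']
      _ ≤ _ := by gcongr
  calc (∫⁻ x, h x ∂μ) ^ p ≤ (A * (c * A) ^ ((1 - p) / p)) ^ p := by
        gcongr
        exact (lintegral_mono_ae hle).trans_eq (lintegral_mul_const'' _ (hh.pow_const p))
    _ = c ^ (1 - p) * (A ^ p * A ^ (1 - p)) := by
        rw [ENNReal.mul_rpow_of_nonneg _ _ hp0.le, ← ENNReal.rpow_mul, div_mul_cancel₀ _ hp0.ne',
          ENNReal.mul_rpow_of_nonneg _ _ hsub, mul_left_comm]
    _ = c ^ (1 - p) * A := by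
        rw [← ENNReal.rpow_add_of_nonneg _ _ hp0.le hsub, add_sub_cancel, ENNReal.rpow_one]

theorem rpow_lintegral_le_of_interval_invariant [∀ k, NeZero (m k)] (hp0 : 0 < p) (hp1 : p ≤ 1)
    {n : ℕ} {h : Gm m → ℝ≥0∞} (hh : Measurable h)
    (hinv : ∀ x y, y ∈ interval m n x → h y = h x) :
    (∫⁻ x, h x ∂haar m) ^ p ≤ (M m n : ℝ≥0∞) ^ (1 - p) * ∫⁻ x, h x ^ p ∂haar m := by
  refine rpow_lintegral_le_of_ae_rpow_le hp0 hp1 hh.aemeasurable (ae_of_all _ fun x => ?_)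
  rw [mul_comm, ← ENNReal.div_le_iff (natCast_M_ne_zero n) (by simp), div_eq_mul_inv,
    ← haar_interval n x, ← setLIntegral_const]
  calc ∫⁻ _ in interval m n x, h x ^ p ∂haar m = ∫⁻ y in interval m n x, h y ^ p ∂haar m :=
        setLIntegral_congr_fun (measurableSet_interval m n x) fun y hy => by rw [hinv x y hy]
    _ ≤ ∫⁻ y, h y ^ p ∂haar m := setLIntegral_le_lintegral _ _

end Quasinorms

/-- The sum `∑_{s ≥ n} M_s^p 1_{I_s(t)}`, which majorizes the `p`-th power of every function that is
at most `M_s` on `I_s(t) ∖ I_{s+1}(t)` for all `s ≥ n` and vanishes off `I_n(t)`. -/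
noncomputable def peakMajorant (m : ℕ → ℕ) (p : ℝ) (n : ℕ) (t x : Gm m) : ℝ≥0∞ :=
  ∑' j, (interval m (n + j) t).indicator (fun _ => (M m (n + j) : ℝ≥0∞) ^ p) x

/-- The constant `(∑_j 2^{j(p-1)})^{1/p}` in the `L_p` bounds for functions dominated by
`peakMajorant`. -/
noncomputable def tailConst (p : ℝ) : ℝ≥0∞ := (1 - 2 ^ (p - 1))⁻¹ ^ (1 / p)

section Peaks

variable {p : ℝ}

theorem tailConst_ne_top (hp0 : 0 ≤ p) (hp1 : p < 1) : tailConst p ≠ ∞ := by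
  refine ENNReal.rpow_ne_top_of_nonneg (by positivity)
    (ENNReal.inv_ne_top.2 (tsub_pos_of_lt ?_).ne')
  exact ENNReal.rpow_lt_one_of_one_lt_of_neg ENNReal.one_lt_two (by linarith)

theorem M_rpow_le_peakMajorant {n s : ℕ} (hs : n ≤ s) {x t : Gm m} (hx : x ∈ interval m s t) :
    (M m s : ℝ≥0∞) ^ p ≤ peakMajorant m p n t x := by
  obtain ⟨j, rfl⟩ := Nat.exists_eq_add_of_le hs
  simpa [hx, peakMajorant] using ENNReal.le_tsum (f := fun j =>
    (interval m (n + j) t).indicator (fun _ => (M m (n + j) : ℝ≥0∞) ^ p) x) j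

variable [∀ k, (m k).AtLeastTwo]

theorem M_add_rpow_mul_inv_le (hp : p ≤ 1) (n j : ℕ) :
    (M m (n + j) : ℝ≥0∞) ^ p * (M m (n + j) : ℝ≥0∞)⁻¹ ≤
      (M m n : ℝ≥0∞) ^ (p - 1) * ((2 : ℝ≥0∞) ^ (p - 1)) ^ j := by
  have hgrowth : (M m n : ℝ≥0∞) * 2 ^ j ≤ M m (n + j) := by
    exact_mod_cast M_mul_two_pow_le (m := m) n j
  calc (M m (n + j) : ℝ≥0∞) ^ p * (M m (n + j) : ℝ≥0∞)⁻¹ = (M m (n + j) : ℝ≥0∞) ^ (p - 1) := by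
        rw [← ENNReal.rpow_neg_one, ← ENNReal.rpow_add _ _ (natCast_M_ne_zero _) (by simp),
          sub_eq_add_neg]
    _ ≤ ((M m n : ℝ≥0∞) * 2 ^ j) ^ (p - 1) := by
        rw [← neg_sub, ENNReal.rpow_neg, ENNReal.rpow_neg, ENNReal.inv_le_inv]
        exact ENNReal.rpow_le_rpow hgrowth (by linarith)
    _ = (M m n : ℝ≥0∞) ^ (p - 1) * ((2 : ℝ≥0∞) ^ (p - 1)) ^ j := by
        rw [ENNReal.mul_rpow_of_ne_top (by simp) (by simp), ← ENNReal.rpow_natCast_mul,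
          mul_comm (j : ℝ), ENNReal.rpow_mul_natCast]

theorem lintegral_peakMajorant_le (hp : p ≤ 1) (n : ℕ) (t : Gm m) :
    ∫⁻ x, peakMajorant m p n t x ∂haar m ≤
      (M m n : ℝ≥0∞) ^ (p - 1) * (1 - 2 ^ (p - 1))⁻¹ := by
  unfold peakMajorant
  rw [lintegral_tsum fun j =>
    (measurable_const.indicator (measurableSet_interval m (n + j) t)).aemeasurable,
    ← ENNReal.tsum_geometric, ← ENNReal.tsum_mul_left]
  refine ENNReal.tsum_le_tsum fun j => ?_
  rw [lintegral_indicator_const (measurableSet_interval m _ t), haar_interval]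
  exact M_add_rpow_mul_inv_le hp n j

theorem eLpNorm'_le_of_rpow_le_peakMajorant {ε : Type*} [ENorm ε] (hp0 : 0 < p) (hp1 : p ≤ 1)
    {g : Gm m → ε} {c : ℝ≥0∞} (n : ℕ) (t : Gm m)
    (hg : ∀ x, ‖g x‖ₑ ^ p ≤ c ^ p * peakMajorant m p n t x) (hc : c ≠ ∞) :
    eLpNorm' g p (haar m) ≤ c * tailConst p * (M m n : ℝ≥0∞) ^ (-(1 / p - 1)) := by
  rw [← ENNReal.rpow_le_rpow_iff hp0, ← lintegral_rpow_enorm_eq_rpow_eLpNorm' hp0]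
  calc ∫⁻ x, ‖g x‖ₑ ^ p ∂haar m ≤ c ^ p * ∫⁻ x, peakMajorant m p n t x ∂haar m := by
        rw [← lintegral_const_mul' _ _ (ENNReal.rpow_ne_top_of_nonneg hp0.le hc)]
        exact lintegral_mono hg
    _ ≤ c ^ p * ((M m n : ℝ≥0∞) ^ (p - 1) * (1 - 2 ^ (p - 1))⁻¹) := by
        gcongr
        exact lintegral_peakMajorant_le hp1 n t
    _ = (c * tailConst p * (M m n : ℝ≥0∞) ^ (-(1 / p - 1))) ^ p := by
        rw [ENNReal.mul_rpow_of_nonneg _ _ hp0.le, ENNReal.mul_rpow_of_nonneg _ _ hp0.le, tailConst,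
          one_div, ENNReal.rpow_inv_rpow hp0.ne', ← ENNReal.rpow_mul,
          show -(p⁻¹ - 1) * p = p - 1 by field_simp; ring]
        ring

end Peaks

section PartialSums

variable [∀ k, (m k).AtLeastTwo] {p : ℝ}

theorem eLpNorm'_kernel_le (hp0 : 0 < p) (hp1 : p ≤ 1) {b : ℕ} (hb : ∀ k, m k ≤ b) (k : ℕ)
    (t : Gm m) : eLpNorm' (kernel m k · t) p (haar m) ≤ b * tailConst p := by
  have hpeak : ∀ x, ‖kernel m k x t‖ₑ ^ p ≤ (b : ℝ≥0∞) ^ p * peakMajorant m p 0 t x := fun x => by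
    obtain ⟨s, hs, hle⟩ := exists_mem_interval_norm_kernel_le k x t
    calc ‖kernel m k x t‖ₑ ^ p ≤ (b * M m s : ℝ≥0∞) ^ p := by
          gcongr
          refine le_trans ?_ (natCast_M_succ_le hb s)
          rw [← ofReal_norm]
          exact ENNReal.ofReal_le_of_le_toReal (by simpa using hle)
      _ = (b : ℝ≥0∞) ^ p * (M m s : ℝ≥0∞) ^ p := ENNReal.mul_rpow_of_nonneg _ _ hp0.le
      _ ≤ (b : ℝ≥0∞) ^ p * peakMajorant m p 0 t x := by
          gcongr
          exact M_rpow_le_peakMajorant s.zero_le hs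
  simpa [M_zero] using eLpNorm'_le_of_rpow_le_peakMajorant hp0 hp1 0 t hpeak (by simp)

theorem measurable_kernel (k : ℕ) : Measurable fun z : Gm m × Gm m => kernel m k z.1 z.2 := by
  unfold kernel
  exact Finset.measurable_fun_sum _ fun i _ => ((measurable_psi i).comp measurable_fst).mul
    (Complex.continuous_conj.measurable.comp ((measurable_psi i).comp measurable_snd))

theorem enorm_partialSum_rpow_le (hp0 : 0 < p) (hp1 : p ≤ 1) {g : Gm m → ℂ} {n k : ℕ}
    (hg : StronglyMeasurable[filtration m n] g) (hk : k ≤ M m n) (x : Gm m) :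
    ‖partialSum m g k x‖ₑ ^ p ≤
      (M m n : ℝ≥0∞) ^ (1 - p) * ∫⁻ t, ‖g t‖ₑ ^ p * ‖kernel m k x t‖ₑ ^ p ∂haar m := by
  have hmeas : Measurable fun t => ‖g t * kernel m k x t‖ₑ :=
    ((measurable_of_stronglyMeasurable_filtration hg).mul
      ((measurable_kernel k).comp measurable_prodMk_left)).enorm
  have hinv : ∀ s t, t ∈ interval m n s →
      ‖g t * kernel m k x t‖ₑ = ‖g s * kernel m k x s‖ₑ := fun s t hst => by
    rw [stronglyMeasurable_filtration_iff.1 hg s t hst, kernel_congr_right hk x hst]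
  simp only [← ENNReal.mul_rpow_of_nonneg _ _ hp0.le, ← enorm_mul]
  refine le_trans ?_ (rpow_lintegral_le_of_interval_invariant hp0 hp1 hmeas hinv)
  rw [partialSum_eq_integral (integrable_of_stronglyMeasurable_filtration hg)]
  gcongr
  exact enorm_integral_le_lintegral_enorm _

theorem eLpNorm'_partialSum_le (hp0 : 0 < p) (hp1 : p ≤ 1) {g : Gm m → ℂ} {n k : ℕ}
    (hg : StronglyMeasurable[filtration m n] g) (hk : k ≤ M m n) {C : ℝ≥0∞}
    (hC : ∀ t, eLpNorm' (kernel m k · t) p (haar m) ≤ C) :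
    eLpNorm' (partialSum m g k) p (haar m) ≤
      C * (M m n : ℝ≥0∞) ^ (1 / p - 1) * eLpNorm' g p (haar m) := by
  have hgm : Measurable g := measurable_of_stronglyMeasurable_filtration hg
  have hK := measurable_kernel (m := m) k
  have hmeas : Measurable fun z : Gm m × Gm m => ‖g z.2‖ₑ ^ p * ‖kernel m k z.1 z.2‖ₑ ^ p :=
    ((hgm.comp measurable_snd).enorm.pow_const p).mul (hK.enorm.pow_const p)
  have hM : (M m n : ℝ≥0∞) ^ (1 - p) ≠ ∞ :=
    ENNReal.rpow_ne_top_of_nonneg (by linarith) (ENNReal.natCast_ne_top _)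
  have hinner : ∀ t, ∫⁻ x, ‖g t‖ₑ ^ p * ‖kernel m k x t‖ₑ ^ p ∂haar m ≤ ‖g t‖ₑ ^ p * C ^ p := by
    intro t
    have hKt : Measurable fun x => kernel m k x t := by fun_prop
    rw [lintegral_const_mul _ (hKt.enorm.pow_const p), lintegral_rpow_enorm_eq_rpow_eLpNorm' hp0]
    gcongr
    exact hC t
  rw [← ENNReal.rpow_le_rpow_iff hp0, ← lintegral_rpow_enorm_eq_rpow_eLpNorm' hp0]
  calc ∫⁻ x, ‖partialSum m g k x‖ₑ ^ p ∂haar m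
      ≤ ∫⁻ x, (M m n : ℝ≥0∞) ^ (1 - p) *
          ∫⁻ t, ‖g t‖ₑ ^ p * ‖kernel m k x t‖ₑ ^ p ∂haar m ∂haar m :=
        lintegral_mono (enorm_partialSum_rpow_le hp0 hp1 hg hk)
    _ = (M m n : ℝ≥0∞) ^ (1 - p) *
          ∫⁻ t, ∫⁻ x, ‖g t‖ₑ ^ p * ‖kernel m k x t‖ₑ ^ p ∂haar m ∂haar m := by
        rw [lintegral_const_mul' _ _ hM, lintegral_lintegral_swap hmeas.aemeasurable]
    _ ≤ (M m n : ℝ≥0∞) ^ (1 - p) * ((∫⁻ t, ‖g t‖ₑ ^ p ∂haar m) * C ^ p) := by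
        rw [← lintegral_mul_const _ (hgm.enorm.pow_const p)]
        gcongr with t
        exact hinner t
    _ = (C * (M m n : ℝ≥0∞) ^ (1 / p - 1) * eLpNorm' g p (haar m)) ^ p := by
        rw [lintegral_rpow_enorm_eq_rpow_eLpNorm' hp0, ENNReal.mul_rpow_of_nonneg _ _ hp0.le,
          ENNReal.mul_rpow_of_nonneg _ _ hp0.le, ← ENNReal.rpow_mul,
          show (1 / p - 1) * p = 1 - p by field_simp]
        ring

end PartialSums

section Limit

theorem ae_iInf_eq_zero_of_tendsto_eLpNorm' {α : Type*} {_ : MeasurableSpace α} {μ : Measure α}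
    {p : ℝ} (hp : 0 < p) {w : ℕ → α → ℝ≥0∞} (hw : ∀ n, Measurable (w n))
    (h : Tendsto (fun n => eLpNorm' (w n) p μ) atTop (𝓝 0)) : ∀ᵐ x ∂μ, ⨅ n, w n x = 0 := by
  have hzero : eLpNorm' (fun x => ⨅ n, w n x) p μ = 0 := le_antisymm
    (ge_of_tendsto' h fun n => eLpNorm'_mono_enorm_ae hp.le (ae_of_all _ fun x => iInf_le _ n))
    zero_le
  exact (eLpNorm'_eq_zero_iff hp (Measurable.iInf hw).aestronglyMeasurable).1 hzero

theorem measurable_maximalFunction {f : ℕ → Gm m → ℂ} (hf : ∀ n, Measurable (f n)) :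
    Measurable (maximalFunction f) :=
  Measurable.iSup fun n => (hf n).enorm

theorem enorm_sub_le_maximalFunction (f : ℕ → Gm m → ℂ) {n k : ℕ} (h : n ≤ k) (x : Gm m) :
    ‖f k x - f n x‖ₑ ≤ maximalFunction (fun k x => f k x - f (min k n) x) x :=
  le_iSup_of_le k (by simp only [min_eq_right h, le_refl])

theorem enorm_limit_sub_le_maximalFunction {f : ℕ → Gm m → ℂ} {n : ℕ} {x : Gm m} {z : ℂ}
    (h : Tendsto (fun k => f k x) atTop (𝓝 z)) :
    ‖z - f n x‖ₑ ≤ maximalFunction (fun k x => f k x - f (min k n) x) x :=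
  le_of_tendsto (h.sub_const (f n x)).enorm <|
    (eventually_ge_atTop n).mono fun _ hk => enorm_sub_le_maximalFunction f hk x

theorem cauchySeq_of_iInf_maximalFunction_eq_zero {f : ℕ → Gm m → ℂ} {x : Gm m}
    (h : ⨅ n, maximalFunction (fun k x => f k x - f (min k n) x) x = 0) :
    CauchySeq fun n => f n x := by
  refine EMetric.cauchySeq_iff'.2 fun ε hε => ?_
  obtain ⟨n, hn⟩ := iInf_lt_iff.1 (h.trans_lt hε)
  refine ⟨n, fun k hk => ?_⟩
  rw [edist_eq_enorm_sub]
  exact (enorm_sub_le_maximalFunction f hk x).trans_lt hn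

theorem tendsto_modulus_of_tendsto_mul [∀ k, NeZero (m k)] {p a : ℝ} {f : ℕ → Gm m → ℂ}
    (ha : 0 ≤ a)
    (hmod : Tendsto (fun n => modulus m p f n * (M m n : ℝ≥0∞) ^ a) atTop (𝓝 0)) :
    Tendsto (modulus m p f) atTop (𝓝 0) :=
  tendsto_of_tendsto_of_tendsto_of_le_of_le tendsto_const_nhds hmod (fun _ => zero_le) fun n =>
    le_mul_of_one_le_right zero_le (one_le_M_rpow ha n)

variable [∀ k, (m k).AtLeastTwo] {p : ℝ} {f : ℕ → Gm m → ℂ} {F : Gm m → ℂ}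

theorem modulus_eq (hf : Martingale f (filtration m) (haar m)) (n : ℕ) :
    modulus m p f n = hpNorm m p fun k x => f k x - f (min k n) x := by
  simp only [modulus, partialSum_M_martingale hf]

theorem ae_exists_tendsto (hp : 0 < p) (hf : Martingale f (filtration m) (haar m))
    (hmod : Tendsto (modulus m p f) atTop (𝓝 0)) :
    ∀ᵐ x ∂haar m, ∃ z, Tendsto (fun n => f n x) atTop (𝓝 z) := by
  have hmeas : ∀ n, Measurable (f n) := fun n =>
    measurable_of_stronglyMeasurable_filtration (hf.1 n)
  have hinf := ae_iInf_eq_zero_of_tendsto_eLpNorm' hp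
    (fun n => measurable_maximalFunction fun k => (hmeas k).sub (hmeas (min k n)))
    (hmod.congr fun n => modulus_eq hf n)
  exact hinf.mono fun x hx =>
    cauchySeq_tendsto_of_complete (cauchySeq_of_iInf_maximalFunction_eq_zero hx)

theorem exists_isLimitFunction (hp : 0 < p) (hf : MemHp m p f)
    (hmod : Tendsto (modulus m p f) atTop (𝓝 0)) :
    ∃ F, MemWeakLp m p F ∧ IsLimitFunction m f F := by
  obtain ⟨F, hF, hlim⟩ := measurable_limit_of_tendsto_metrizable_ae
    (fun n => (measurable_of_stronglyMeasurable_filtration (hf.1.1 n)).aemeasurable)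
    (ae_exists_tendsto hp hf.1 hmod)
  have hle : ∀ᵐ x ∂haar m, ‖F x‖ₑ ≤ maximalFunction f x := hlim.mono fun x hx =>
    le_of_tendsto' hx.enorm (le_iSup fun n => ‖f n x‖ₑ)
  exact ⟨F, ⟨hF, (weakLpNorm_le_eLpNorm' hp hF.aemeasurable).trans_lt
    ((eLpNorm'_le_hpNorm hp.le hle).trans_lt hf.2)⟩, hlim⟩

theorem eLpNorm'_succ_sub_le_modulus (hp : 0 ≤ p) (hf : Martingale f (filtration m) (haar m))
    (n : ℕ) : eLpNorm' (fun x => f (n + 1) x - f n x) p (haar m) ≤ modulus m p f n := by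
  rw [modulus_eq hf]
  exact eLpNorm'_le_hpNorm hp (ae_of_all _ (enorm_sub_le_maximalFunction f n.le_succ))

theorem eLpNorm'_sub_limit_le_modulus (hp : 0 ≤ p) (hf : Martingale f (filtration m) (haar m))
    (hF : IsLimitFunction m f F) (n : ℕ) :
    eLpNorm' (fun x => f n x - F x) p (haar m) ≤ modulus m p f n := by
  rw [modulus_eq hf]
  refine eLpNorm'_le_hpNorm hp (hF.mono fun x hx => ?_)
  rw [enorm_sub_rev]
  exact enorm_limit_sub_le_maximalFunction hx

end Limit

section Convergence

variable [∀ k, (m k).AtLeastTwo] {p : ℝ} {f : ℕ → Gm m → ℂ} {F : Gm m → ℂ}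

theorem measurable_martPartialSum (f : ℕ → Gm m → ℂ) (k : ℕ) :
    Measurable (martPartialSum m f k) :=
  Finset.measurable_fun_sum _ fun i _ => (measurable_psi i).const_mul _

theorem eLpNorm'_martPartialSum_sub_le (hp0 : 0 < p) (hp1 : p ≤ 1) {b : ℕ} (hb : ∀ k, m k ≤ b)
    (hf : Martingale f (filtration m) (haar m)) {n k : ℕ} (hn : M m n ≤ k)
    (hk : k ≤ M m (n + 1)) :
    eLpNorm' (fun x => martPartialSum m f k x - f n x) p (haar m) ≤
      b * tailConst p * (b : ℝ≥0∞) ^ (1 / p - 1) *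
        (modulus m p f n * (M m n : ℝ≥0∞) ^ (1 / p - 1)) := by
  have hexp : 0 ≤ 1 / p - 1 := sub_nonneg.2 (one_le_one_div hp0 hp1)
  simp only [martPartialSum_sub_eq hf hn hk]
  calc eLpNorm' (partialSum m (fun y => f (n + 1) y - f n y) k) p (haar m)
      ≤ b * tailConst p * (M m (n + 1) : ℝ≥0∞) ^ (1 / p - 1) *
          eLpNorm' (fun y => f (n + 1) y - f n y) p (haar m) :=
        eLpNorm'_partialSum_le hp0 hp1
          ((hf.1 (n + 1)).sub ((hf.1 n).mono ((filtration m).mono n.le_succ))) hk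
          (eLpNorm'_kernel_le hp0 hp1 hb k)
    _ ≤ b * tailConst p * (b * M m n : ℝ≥0∞) ^ (1 / p - 1) * modulus m p f n := by
        gcongr
        · exact natCast_M_succ_le hb n
        · exact eLpNorm'_succ_sub_le_modulus hp0.le hf n
    _ = _ := by
        rw [ENNReal.mul_rpow_of_nonneg _ _ hexp]
        ring

theorem eLpNorm'_martPartialSum_sub_limit_le (hp0 : 0 < p) (hp1 : p ≤ 1) {b : ℕ}
    (hb : ∀ k, m k ≤ b) (hf : Martingale f (filtration m) (haar m))
    (hF : IsLimitFunction m f F) {n k : ℕ} (hn : M m n ≤ k) (hk : k ≤ M m (n + 1)) :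
    eLpNorm' (fun x => martPartialSum m f k x - F x) p (haar m) ≤
      2 ^ (1 / p - 1) * (b * tailConst p * (b : ℝ≥0∞) ^ (1 / p - 1) + 1) *
        (modulus m p f n * (M m n : ℝ≥0∞) ^ (1 / p - 1)) := by
  have hexp : 0 ≤ 1 / p - 1 := sub_nonneg.2 (one_le_one_div hp0 hp1)
  have hmeas : Measurable fun x => martPartialSum m f k x - f n x :=
    (measurable_martPartialSum f k).sub (measurable_of_stronglyMeasurable_filtration (hf.1 n))
  have hlimit : eLpNorm' (fun x => f n x - F x) p (haar m) ≤
      modulus m p f n * (M m n : ℝ≥0∞) ^ (1 / p - 1) :=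
    (eLpNorm'_sub_limit_le_modulus hp0.le hf hF n).trans <|
      le_mul_of_one_le_right zero_le (one_le_M_rpow hexp n)
  have hsplit : (fun x => martPartialSum m f k x - F x) =
      (fun x => martPartialSum m f k x - f n x) + fun x => f n x - F x :=
    funext fun x => (sub_add_sub_cancel _ _ _).symm
  rw [hsplit, mul_assoc, add_mul, one_mul]
  exact (eLpNorm'_add_le_of_le_one hmeas.aestronglyMeasurable hp0.le hp1).trans <|
    mul_le_mul_right (add_le_add (eLpNorm'_martPartialSum_sub_le hp0 hp1 hb hf hn hk) hlimit) _

theorem tendsto_eLpNorm'_martPartialSum_sub (hp0 : 0 < p) (hp1 : p < 1)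
    (hm : BddAbove (Set.range m)) (hf : Martingale f (filtration m) (haar m))
    (hF : IsLimitFunction m f F)
    (hmod : Tendsto (fun n => modulus m p f n * (M m n : ℝ≥0∞) ^ (1 / p - 1)) atTop (𝓝 0)) :
    Tendsto (fun k => eLpNorm' (fun x => martPartialSum m f k x - F x) p (haar m)) atTop
      (𝓝 0) := by
  obtain ⟨b, hb⟩ := hm
  have hb : ∀ k, m k ≤ b := fun k => hb ⟨k, rfl⟩
  have hexp : 0 ≤ 1 / p - 1 := sub_nonneg.2 (one_le_one_div hp0 hp1.le)
  have hC : 2 ^ (1 / p - 1) * (b * tailConst p * (b : ℝ≥0∞) ^ (1 / p - 1) + 1) ≠ ∞ := by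
    have htail := tailConst_ne_top hp0.le hp1
    finiteness
  have hbound := ENNReal.Tendsto.const_mul hmod (Or.inr hC)
  rw [mul_zero] at hbound
  exact tendsto_zero_of_forall_M_le hbound fun n k hn hk =>
    eLpNorm'_martPartialSum_sub_limit_le hp0 hp1.le hb hf hF hn hk

theorem tendsto_weakLpNorm_martPartialSum_sub (hp0 : 0 < p) (hp1 : p < 1)
    (hm : BddAbove (Set.range m)) (hf : Martingale f (filtration m) (haar m))
    (hFm : AEMeasurable F (haar m)) (hF : IsLimitFunction m f F)
    (hmod : Tendsto (fun n => modulus m p f n * (M m n : ℝ≥0∞) ^ (1 / p - 1)) atTop (𝓝 0)) :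
    Tendsto (fun k => weakLpNorm m p fun x => martPartialSum m f k x - F x) atTop (𝓝 0) :=
  tendsto_of_tendsto_of_tendsto_of_le_of_le tendsto_const_nhds
    (tendsto_eLpNorm'_martPartialSum_sub hp0 hp1 hm hf hF hmod) (fun _ => zero_le) fun k =>
    weakLpNorm_le_eLpNorm' hp0 ((measurable_martPartialSum f k).aemeasurable.sub hFm)

end Convergence

section WeakQuasinorm

variable {p : ℝ}

theorem mul_haar_rpow_le_weakLpNorm (g : Gm m → ℂ) {t : ℝ≥0} (ht : 0 < t) :
    (t : ℝ≥0∞) * haar m {x | (t : ℝ≥0∞) < ‖g x‖ₑ} ^ (1 / p) ≤ weakLpNorm m p g :=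
  le_iSup₂_of_le t ht le_rfl

theorem weakLpNorm_sub_le (hp0 : 0 < p) (hp1 : p ≤ 1) (g h : Gm m → ℂ) :
    weakLpNorm m p (fun x => g x - h x) ≤
      2 * 2 ^ (1 / p - 1) * (weakLpNorm m p g + weakLpNorm m p h) := by
  refine iSup₂_le fun t ht => ?_
  set A := {x | ((t / 2 : ℝ≥0) : ℝ≥0∞) < ‖g x‖ₑ}
  set B := {x | ((t / 2 : ℝ≥0) : ℝ≥0∞) < ‖h x‖ₑ}
  have ht2 : (t : ℝ≥0∞) = 2 * (t / 2 : ℝ≥0) := by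
    exact_mod_cast (mul_div_cancel₀ t two_ne_zero).symm
  have hsub : {x | (t : ℝ≥0∞) < ‖g x - h x‖ₑ} ⊆ A ∪ B := fun x hx => by
    by_contra hAB
    simp only [A, B, Set.mem_union, Set.mem_ofPred_eq, not_or, not_lt] at hAB
    refine hx.not_ge (enorm_sub_le.trans ((add_le_add hAB.1 hAB.2).trans_eq ?_))
    rw [ht2, two_mul]
  calc (t : ℝ≥0∞) * haar m {x | (t : ℝ≥0∞) < ‖g x - h x‖ₑ} ^ (1 / p)
      ≤ t * (haar m A + haar m B) ^ (1 / p) := by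
        gcongr
        exact (measure_mono hsub).trans (measure_union_le A B)
    _ ≤ t * (2 ^ (1 / p - 1) * (haar m A ^ (1 / p) + haar m B ^ (1 / p))) := by
        gcongr
        exact ENNReal.rpow_add_le_mul_rpow_add_rpow _ _ (one_le_one_div hp0 hp1)
    _ = 2 * 2 ^ (1 / p - 1) * ((t / 2 : ℝ≥0) * haar m A ^ (1 / p) +
          (t / 2 : ℝ≥0) * haar m B ^ (1 / p)) := by
        rw [ht2]
        ring
    _ ≤ 2 * 2 ^ (1 / p - 1) * (weakLpNorm m p g + weakLpNorm m p h) := by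
        gcongr <;> exact mul_haar_rpow_le_weakLpNorm _ (half_pos ht)

theorem le_weakLpNorm_of_forall_le_enorm [∀ k, NeZero (m k)] {g : Gm m → ℂ} {c : ℝ≥0∞}
    (hc : ∀ x, c ≤ ‖g x‖ₑ) : c ≤ weakLpNorm m p g := by
  refine ENNReal.le_of_forall_nnreal_lt fun t ht => ?_
  obtain rfl | ht0 := eq_zero_or_pos t
  · simp
  have huniv : {x | (t : ℝ≥0∞) < ‖g x‖ₑ} = Set.univ :=
    Set.eq_univ_of_forall fun x => ht.trans_le (hc x)
  have hle := mul_haar_rpow_le_weakLpNorm (p := p) g ht0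
  rwa [huniv, measure_univ, ENNReal.one_rpow, mul_one] at hle

theorem enorm_martCoeff_le_weakLpNorm [∀ k, NeZero (m k)] (f : ℕ → Gm m → ℂ) (k : ℕ) :
    ‖martCoeff m f k‖ₑ ≤
      weakLpNorm m p fun x => martPartialSum m f (k + 1) x - martPartialSum m f k x := by
  refine le_weakLpNorm_of_forall_le_enorm fun x => ?_
  rw [martPartialSum, martPartialSum, Finset.sum_range_succ, add_sub_cancel_left, enorm_mul,
    ← ofReal_norm (psi m k x), norm_psi, ENNReal.ofReal_one, mul_one]

theorem tendsto_martCoeff_zero [∀ k, NeZero (m k)] (hp0 : 0 < p) (hp1 : p ≤ 1)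
    {f : ℕ → Gm m → ℂ} {F : Gm m → ℂ}
    (h : Tendsto (fun k => weakLpNorm m p fun x => martPartialSum m f k x - F x) atTop (𝓝 0)) :
    Tendsto (martCoeff m f) atTop (𝓝 0) := by
  have hexp : 0 ≤ 1 / p - 1 := sub_nonneg.2 (one_le_one_div hp0 hp1)
  have hC : (2 : ℝ≥0∞) * 2 ^ (1 / p - 1) ≠ ∞ :=
    ENNReal.mul_ne_top ENNReal.ofNat_ne_top <|
      ENNReal.rpow_ne_top_of_nonneg hexp ENNReal.ofNat_ne_top
  have hbound := ENNReal.Tendsto.const_mul ((h.comp (tendsto_add_atTop_nat 1)).add h)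
    (Or.inr hC)
  rw [add_zero, mul_zero] at hbound
  refine tendsto_zero_iff_enorm_tendsto_zero.2 <| tendsto_of_tendsto_of_tendsto_of_le_of_le
    tendsto_const_nhds hbound (fun _ => zero_le) fun k => ?_
  refine (enorm_martCoeff_le_weakLpNorm (p := p) f k).trans ?_
  simpa using weakLpNorm_sub_le hp0 hp1 (fun x => martPartialSum m f (k + 1) x - F x)
    fun x => martPartialSum m f k x - F x

end WeakQuasinorm

theorem rpow_enorm_sum_le {ι : Type*} {p : ℝ} (hp0 : 0 < p) (hp1 : p ≤ 1) (s : Finset ι)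
    (g : ι → ℂ) : ‖∑ i ∈ s, g i‖ₑ ^ p ≤ ∑ i ∈ s, ‖g i‖ₑ ^ p :=
  Finset.le_sum_of_subadditive (fun z : ℂ => ‖z‖ₑ ^ p) (by simp [hp0])
    (fun z w => (ENNReal.rpow_le_rpow (enorm_add_le z w) hp0.le).trans
      (ENNReal.rpow_add_le_add_rpow _ _ hp0.le hp1)) s g

/-- The block `r_j D_{M_j} = ∑_{M_j ≤ i < 2 M_j} ψ_i` of the Vilenkin system, the `j`-th martingale
difference of `lacunaryMartingale`. -/
noncomputable def dirichletBlock (m : ℕ → ℕ) (j : ℕ) (x : Gm m) : ℂ :=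
  ∑ i ∈ Finset.range (M m j), psi m (M m j + i) x

/-- The martingale `(∑_{j<n} r_j D_{M_j})_n`, the counterexample of part (b). -/
noncomputable def lacunaryMartingale (m : ℕ → ℕ) (n : ℕ) (x : Gm m) : ℂ :=
  ∑ j ∈ Finset.range n, dirichletBlock m j x

section Lacunary

theorem lacunaryMartingale_succ (n : ℕ) (x : Gm m) :
    lacunaryMartingale m (n + 1) x = lacunaryMartingale m n x + dirichletBlock m n x :=
  Finset.sum_range_succ _ _

variable [∀ k, (m k).AtLeastTwo]

theorem dirichletBlock_eq (j : ℕ) (x : Gm m) :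
    dirichletBlock m j x = rademacher m j x * kernel m (M m j) x 0 := by
  rw [dirichletBlock, kernel, Finset.mul_sum]
  refine Finset.sum_congr rfl fun i hi => ?_
  have hblock := psi_mul_M_add (Finset.mem_range.1 hi) 1 x
  rw [psi_mul_M Nat.AtLeastTwo.prop, pow_one, one_mul] at hblock
  rw [hblock, psi_apply_zero, map_one, mul_one]

theorem enorm_dirichletBlock (j : ℕ) (x : Gm m) :
    ‖dirichletBlock m j x‖ₑ = (interval m j 0).indicator (fun _ => (M m j : ℝ≥0∞)) x := by
  rw [dirichletBlock_eq]
  by_cases h : x ∈ interval m j 0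
  · rw [Set.indicator_of_mem h, kernel_M_of_mem h, ← ofReal_norm, norm_mul, norm_rademacher]
    simp
  · simp [kernel_M_of_notMem h, h]

theorem stronglyMeasurable_dirichletBlock (j : ℕ) :
    StronglyMeasurable[filtration m (j + 1)] (dirichletBlock m j) :=
  Finset.stronglyMeasurable_fun_sum _ fun i hi => stronglyMeasurable_filtration_psi <| by
    have hi : i < M m j := Finset.mem_range.1 hi
    have hgrowth := M_mul_two_pow_le (m := m) j 1
    omega

theorem integrable_dirichletBlock (j : ℕ) : Integrable (dirichletBlock m j) (haar m) :=
  integrable_of_stronglyMeasurable_filtration (stronglyMeasurable_dirichletBlock j)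

theorem setIntegral_psi_eq_zero {n i : ℕ} (hi : M m n ≤ i) {s : Set (Gm m)}
    (hs : MeasurableSet[filtration m n] s) : ∫ x in s, psi m i x ∂haar m = 0 := by
  have hcoeff : fourierCoeff m (s.indicator fun _ => 1) i = 0 :=
    fourierCoeff_eq_zero (stronglyMeasurable_const.indicator hs) hi
  rw [← map_eq_zero (starRingEnd ℂ), ← integral_conj,
    ← integral_indicator ((filtration m).le n s hs), ← hcoeff, fourierCoeff]
  refine integral_congr_ae (ae_of_all _ fun x => ?_)
  by_cases h : x ∈ s <;> simp [h]

theorem setIntegral_dirichletBlock_eq_zero {n : ℕ} {s : Set (Gm m)}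
    (hs : MeasurableSet[filtration m n] s) : ∫ x in s, dirichletBlock m n x ∂haar m = 0 := by
  unfold dirichletBlock
  rw [integral_finsetSum _ fun i _ => (integrable_psi _).integrableOn]
  exact Finset.sum_eq_zero fun i _ => setIntegral_psi_eq_zero (Nat.le_add_right _ _) hs

theorem stronglyMeasurable_lacunaryMartingale (n : ℕ) :
    StronglyMeasurable[filtration m n] (lacunaryMartingale m n) :=
  Finset.stronglyMeasurable_fun_sum _ fun j hj => (stronglyMeasurable_dirichletBlock j).mono
    ((filtration m).mono (Nat.succ_le_of_lt (Finset.mem_range.1 hj)))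

theorem martingale_lacunaryMartingale :
    Martingale (lacunaryMartingale m) (filtration m) (haar m) := by
  have hint : ∀ n, Integrable (lacunaryMartingale m n) (haar m) := fun n =>
    integrable_of_stronglyMeasurable_filtration (stronglyMeasurable_lacunaryMartingale n)
  refine martingale_of_setIntegral_eq_succ stronglyMeasurable_lacunaryMartingale hint
    fun n s hs => ?_
  simp only [lacunaryMartingale_succ]
  rw [integral_add (hint n).integrableOn (integrable_dirichletBlock n).integrableOn,
    setIntegral_dirichletBlock_eq_zero hs, add_zero]

theorem fourierCoeff_dirichletBlock_self (n : ℕ) :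
    fourierCoeff m (dirichletBlock m n) (M m n) = 1 := by
  unfold dirichletBlock
  rw [fourierCoeff_sum _ fun i _ => integrable_psi _]
  simp [fourierCoeff_psi, (M_pos (m := m) n).ne']

theorem martCoeff_lacunaryMartingale (n : ℕ) : martCoeff m (lacunaryMartingale m) (M m n) = 1 := by
  have hf := martingale_lacunaryMartingale (m := m)
  have hblock : dirichletBlock m n =
      fun x => lacunaryMartingale m (n + 1) x - lacunaryMartingale m n x :=
    funext fun x => by rw [lacunaryMartingale_succ, add_sub_cancel_left]
  rw [martCoeff_eq hf (M_strictMono (m := m) n.lt_succ_self),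
    ← fourierCoeff_dirichletBlock_self (m := m) n, hblock,
    fourierCoeff_sub (hf.integrable _) (hf.integrable _),
    fourierCoeff_eq_zero (stronglyMeasurable_lacunaryMartingale n) le_rfl, sub_zero]

variable {p : ℝ}

theorem enorm_lacunaryMartingale_sub_rpow_le_peakMajorant (hp0 : 0 < p) (hp1 : p ≤ 1) (n k : ℕ)
    (x : Gm m) :
    ‖lacunaryMartingale m k x - lacunaryMartingale m (min k n) x‖ₑ ^ p ≤
      peakMajorant m p n 0 x := by
  rcases le_total k n with h | h
  · simp [min_eq_left h, hp0]
  obtain ⟨l, rfl⟩ := Nat.exists_eq_add_of_le h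
  rw [min_eq_right h, lacunaryMartingale, lacunaryMartingale, Finset.sum_range_add,
    add_sub_cancel_left]
  calc ‖∑ j ∈ Finset.range l, dirichletBlock m (n + j) x‖ₑ ^ p
      ≤ ∑ j ∈ Finset.range l, ‖dirichletBlock m (n + j) x‖ₑ ^ p := rpow_enorm_sum_le hp0 hp1 _ _
    _ = ∑ j ∈ Finset.range l,
          (interval m (n + j) 0).indicator (fun _ => (M m (n + j) : ℝ≥0∞) ^ p) x := by
        refine Finset.sum_congr rfl fun j _ => ?_
        rw [enorm_dirichletBlock]
        by_cases hx : x ∈ interval m (n + j) 0 <;> simp [hx, hp0]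
    _ ≤ peakMajorant m p n 0 x := ENNReal.sum_le_tsum _

theorem modulus_lacunaryMartingale_le (hp0 : 0 < p) (hp1 : p ≤ 1) (n : ℕ) :
    modulus m p (lacunaryMartingale m) n ≤
      tailConst p * (M m n : ℝ≥0∞) ^ (-(1 / p - 1)) := by
  rw [modulus_eq martingale_lacunaryMartingale, hpNorm_eq_eLpNorm', ← one_mul (tailConst p)]
  refine eLpNorm'_le_of_rpow_le_peakMajorant hp0 hp1 n 0 (fun x => ?_) ENNReal.one_ne_top
  rw [ENNReal.one_rpow, one_mul, ← ENNReal.le_rpow_inv_iff hp0]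
  exact iSup_le fun k => (ENNReal.le_rpow_inv_iff hp0).2
    (enorm_lacunaryMartingale_sub_rpow_le_peakMajorant hp0 hp1 n k x)

theorem memHp_lacunaryMartingale (hp0 : 0 < p) (hp1 : p < 1) :
    MemHp m p (lacunaryMartingale m) := by
  refine ⟨martingale_lacunaryMartingale, ?_⟩
  have hnorm : hpNorm m p (lacunaryMartingale m) = modulus m p (lacunaryMartingale m) 0 := by
    rw [modulus_eq martingale_lacunaryMartingale]
    have hzero : ∀ x, lacunaryMartingale m 0 x = 0 := fun _ => Finset.sum_range_zero _
    simp only [Nat.min_zero, hzero, sub_zero]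
  have hle := modulus_lacunaryMartingale_le (m := m) hp0 hp1.le 0
  rw [M_zero, Nat.cast_one, ENNReal.one_rpow, mul_one] at hle
  exact (hnorm.trans_le hle).trans_lt (tailConst_ne_top hp0.le hp1).lt_top

theorem tendsto_modulus_lacunaryMartingale (hp0 : 0 < p) (hp1 : p < 1) :
    Tendsto (modulus m p (lacunaryMartingale m)) atTop (𝓝 0) := by
  have hexp : -(1 / p - 1) < 0 := neg_lt_zero.2 (sub_pos.2 (one_lt_one_div hp0 hp1))
  have hbound := ENNReal.Tendsto.const_mul (tendsto_M_rpow_of_neg (m := m) hexp)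
    (Or.inr (tailConst_ne_top hp0.le hp1))
  rw [mul_zero] at hbound
  exact tendsto_of_tendsto_of_tendsto_of_le_of_le tendsto_const_nhds hbound (fun _ => zero_le)
    (modulus_lacunaryMartingale_le hp0 hp1.le)

theorem not_tendsto_weakLpNorm_lacunaryMartingale (hp0 : 0 < p) (hp1 : p ≤ 1) (F : Gm m → ℂ) :
    ¬ Tendsto (fun k => weakLpNorm m p fun x =>
      martPartialSum m (lacunaryMartingale m) k x - F x) atTop (𝓝 0) := fun h => by
  have hzero := (tendsto_martCoeff_zero hp0 hp1 h).comp (tendsto_M_atTop (m := m))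
  exact one_ne_zero <| tendsto_nhds_unique (tendsto_const_nhds.congr fun n =>
    (martCoeff_lacunaryMartingale n).symm) hzero

end Lacunary

end Vilenkin

theorem theorem3 (m : ℕ → ℕ) (hm : ∀ k, 2 ≤ m k) (p : ℝ) (hp0 : 0 < p) (hp1 : p < 1) :
    (BddAbove (Set.range m) →
      ∀ f : ℕ → Vilenkin.Gm m → ℂ, Vilenkin.MemHp m p f →
        Tendsto (fun n : ℕ => Vilenkin.modulus m p f n *
          ENNReal.ofReal ((Vilenkin.M m n : ℝ) ^ (1 / p - 1))) atTop (𝓝 0) →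
        ∃ F : Vilenkin.Gm m → ℂ, Vilenkin.MemWeakLp m p F ∧ Vilenkin.IsLimitFunction m f F ∧
          Tendsto (fun k : ℕ => Vilenkin.weakLpNorm m p
            (fun x => Vilenkin.martPartialSum m f k x - F x)) atTop (𝓝 0)) ∧
    (∃ f : ℕ → Vilenkin.Gm m → ℂ, Vilenkin.MemHp m p f ∧
      (∃ C : ℝ≥0, ∀ᶠ n : ℕ in atTop, Vilenkin.modulus m p f (2 * n) ≤
        C * ENNReal.ofReal ((Vilenkin.M m (2 * n) : ℝ) ^ (-(1 / p - 1)))) ∧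
      ∃ F : Vilenkin.Gm m → ℂ, Vilenkin.MemWeakLp m p F ∧ Vilenkin.IsLimitFunction m f F ∧
        ¬ Tendsto (fun k : ℕ => Vilenkin.weakLpNorm m p
            (fun x => Vilenkin.martPartialSum m f k x - F x)) atTop (𝓝 0)) := by
  have : ∀ k, (m k).AtLeastTwo := fun k => ⟨hm k⟩
  simp only [Vilenkin.ofReal_M_rpow]
  refine ⟨fun hbdd f hf hmod => ?_, ?_⟩
  · have hexp : 0 ≤ 1 / p - 1 := sub_nonneg.2 (one_le_one_div hp0 hp1.le)
    obtain ⟨F, hFmem, hF⟩ := Vilenkin.exists_isLimitFunction hp0 hf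
      (Vilenkin.tendsto_modulus_of_tendsto_mul hexp hmod)
    exact ⟨F, hFmem, hF, Vilenkin.tendsto_weakLpNorm_martPartialSum_sub hp0 hp1 hbdd hf.1
      hFmem.1.aemeasurable hF hmod⟩
  · have hf := Vilenkin.memHp_lacunaryMartingale (m := m) hp0 hp1
    obtain ⟨F, hFmem, hF⟩ := Vilenkin.exists_isLimitFunction hp0 hf
      (Vilenkin.tendsto_modulus_lacunaryMartingale hp0 hp1)
    refine ⟨_, hf, ⟨(Vilenkin.tailConst p).toNNReal, .of_forall fun n => ?_⟩, F, hFmem, hF,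
      Vilenkin.not_tendsto_weakLpNorm_lacunaryMartingale hp0 hp1.le F⟩
    rw [ENNReal.coe_toNNReal (Vilenkin.tailConst_ne_top hp0.le hp1)]
    exact Vilenkin.modulus_lacunaryMartingale_le hp0 hp1.le (2 * n)
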